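/- Theorem. Let $T>0$, $0<H<1$, and let $\{B^H_t\}_{t\ge 0}$ be a fractional Brownian motion with Hurst parameter $H$ on a probability space, that is, a centred Gaussian process with almost surely continuous sample paths and covariance $\mathbb{E}[B^H_sB^H_t]=\frac{\sigma^2}{2}\left(s^{2H}+t^{2H}-|t-s|^{2H}\right)$, $s,t\ge 0$, for some $\sigma>0$ (any normalization is allowed). Let $X_0$ be a real random variable on the same space with $\mathbb{E}[|X_0|^2]<\infty$, and let $\{X_t\}_{0\le t\le T}$ be the pathwise solution of the random ordinary differential equation $dX_t/dt=-X_t+B^H_t$, $0\le t\le T$, with initial condition $X_0$, i.e. almost surely $X_t=X_0+\int_0^t(-X_s+B^H_s)\,ds$ for all $t\in[0,T]$. For $N\ge 1$ put $\Delta t_N=T/N$ and $t_j=j\Delta t_N$, and let $X^N_{t_j}$, $j=0,\dots,N$, be the Euler approximation $X^N_{0}=X_0$, $X^N_{t_j}=X^N_{t_{j-1}}+\Delta t_N\left(-X^N_{t_{j-1}}+B^H_{t_{j-1}}\right)$. Then there exist constants $c_1,c_2\ge 0$, independent of $N$, such that $$\max_{j=0,\dots,N}\mathbb{E}\left[\left|X_{t_j}-X^N_{t_j}\right|\right]\le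 c_1\,\Delta t_N+c_2\,\Delta t_N^{H+1/2}\qquad\text{for all } N\ge 1,$$ where all these expectations are finite. Consequently, the Euler scheme is of strong order $\theta=H+1/2$ if $0<H<1/2$ and of strong order $\theta=1$ if $1/2\le H<1$, where strong order $\theta$ means that there is a constant $C\ge 0$ such that $\max_{j=0,\dots,N}\mathbb{E}\left[|X_{t_j}-X^N_{t_j}|\right]\le C\,\Delta t_N^{\theta}$ for all $N\ge 1$. -/

import Mathlib

open MeasureTheory ProbabilityTheory
open scoped NNReal

noncomputable section

/-- The process `B`, indexed by `[0, ∞)`, is a **fractional Brownian motion** with Hurst parameter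
`H` and scale `σ` (the standard deviation of `B 1`): a centred Gaussian process with covariance
`E[B_s B_t] = σ² / 2 * (s ^ (2H) + t ^ (2H) - |t - s| ^ (2H))` and almost surely continuous
sample paths. The normalised fractional Brownian motion has `σ = 1`; other normalisations, such as
that of the moving average representation with prefactor `1 / Γ(H + 1/2)`, have other values
of `σ`. -/
structure IsFractionalBrownianMotion {Ω : Type*} [MeasurableSpace Ω] (H σ : ℝ)
    (B : ℝ≥0 → Ω → ℝ) (P : Measure Ω) : Prop where
  isGaussianProcess : IsGaussianProcess B P
  mean_eq_zero : ∀ t : ℝ≥0, ∫ ω, B t ω ∂P = 0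
  covariance_eq : ∀ s t : ℝ≥0, cov[B s, B t; P] =
    σ ^ 2 / 2 * ((s : ℝ) ^ (2 * H) + (t : ℝ) ^ (2 * H) - |(t : ℝ) - (s : ℝ)| ^ (2 * H))
  continuous_paths : ∀ᵐ ω ∂P, Continuous fun t : ℝ≥0 => B t ω

/-- The process `X` is a pathwise solution, in the sense of Carathéodory, of the random ordinary
differential equation `dX_t/dt = f(t, X_t, Y_t)` on `[0, T]` with initial condition `X₀`: almost
surely, `X_t = X₀ + ∫_0^t f(s, X_s, Y_s) ds` for all `t ∈ [0, T]`, with an integrable integrand. -/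
def IsRODESolution {Ω E F : Type*} [MeasurableSpace Ω] [NormedAddCommGroup E] [NormedSpace ℝ E]
    (f : ℝ → E → F → E) (T : ℝ) (Y : ℝ≥0 → Ω → F) (X₀ : Ω → E) (X : ℝ → Ω → E)
    (P : Measure Ω) : Prop :=
  ∀ᵐ ω ∂P,
    IntervalIntegrable (fun s : ℝ => f s (X s ω) (Y s.toNNReal ω)) volume 0 T ∧
    ∀ t ∈ Set.Icc (0 : ℝ) T, X t ω = X₀ ω + ∫ s in (0 : ℝ)..t, f s (X s ω) (Y s.toNNReal ω)

/-- The time step `Δt_N = T / N` of the uniform mesh of `[0, T]` with `N` steps. -/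
def timeStep (T : ℝ) (N : ℕ) : ℝ := T / N

/-- The mesh point `t_j = j Δt_N`. -/
def meshPoint (T : ℝ) (N j : ℕ) : ℝ := j * timeStep T N

/-- The Euler scheme with `N` steps on `[0, T]` for `dX_t/dt = f(t, X_t, Y_t)` with initial
condition `X₀`; `eulerScheme f T Y X₀ N j` is the approximation at the mesh point `t_j`. -/
def eulerScheme {Ω E F : Type*} [NormedAddCommGroup E] [NormedSpace ℝ E]
    (f : ℝ → E → F → E) (T : ℝ) (Y : ℝ≥0 → Ω → F) (X₀ : Ω → E) (N : ℕ) : ℕ → Ω → E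
  | 0 => X₀
  | j + 1 => fun ω => eulerScheme f T Y X₀ N j ω + timeStep T N •
      f (meshPoint T N j) (eulerScheme f T Y X₀ N j ω) (Y (meshPoint T N j).toNNReal ω)

/-- The strong error `max_{j = 0, …, N} E ‖X_{t_j} - X^N_{t_j}‖`, where `XN N j` is the
approximation at the mesh point `t_j` of the mesh with `N` steps. -/
def strongError {Ω E : Type*} [MeasurableSpace Ω] [NormedAddCommGroup E]
    (T : ℝ) (X : ℝ → Ω → E) (XN : ℕ → ℕ → Ω → E) (P : Measure Ω) (N : ℕ) : ℝ :=
  (Finset.range (N + 1)).sup' Finset.nonempty_range_add_one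
    fun j => ∫ ω, ‖X (meshPoint T N j) ω - XN N j ω‖ ∂P

/-- All the expectations `E ‖X_{t_j} - X^N_{t_j}‖`, `N ≥ 1`, `j = 0, …, N`, are finite. -/
def IntegrableErrors {Ω E : Type*} [MeasurableSpace Ω] [NormedAddCommGroup E]
    (T : ℝ) (X : ℝ → Ω → E) (XN : ℕ → ℕ → Ω → E) (P : Measure Ω) : Prop :=
  ∀ N : ℕ, 1 ≤ N → ∀ j ≤ N, Integrable (fun ω => X (meshPoint T N j) ω - XN N j ω) P

/-- The approximations `XN` converge to `X` on `[0, T]` with strong order `θ`: for some `C ≥ 0`,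
`max_{j = 0, …, N} E ‖X_{t_j} - X^N_{t_j}‖ ≤ C Δt_N ^ θ` for all `N ≥ 1`. -/
def HasStrongOrder {Ω E : Type*} [MeasurableSpace Ω] [NormedAddCommGroup E]
    (θ T : ℝ) (X : ℝ → Ω → E) (XN : ℕ → ℕ → Ω → E) (P : Measure Ω) : Prop :=
  IntegrableErrors T X XN P ∧
  ∃ C : ℝ, 0 ≤ C ∧ ∀ N : ℕ, 1 ≤ N → strongError T X XN P N ≤ C * timeStep T N ^ θ

end

/-! Write `Δ` for the time step. The error satisfies `e (j+1) = (1 - Δ) * e j + R j + D j`, where `R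
j` and `D j` are the integrals over the `j`-th cell of `X_{t_j} - X_s` and `B_s - B_{t_j}`. If `Δ ≤
1`, the propagation weights are powers of `1 - Δ` and lie in `[0, 1]`. Since `X` is absolutely
continuous, the `|R j|` sum to `O(Δ)` path by path (`linearODE_euler_error_le`).

Summing the `|D j|` would only give order `H`; the gain comes from the second moment of the weighted
sum of the `D j` (`integral_abs_sum_le`), which needs only upper bounds `K i j ≥ 0` on increment
covariances (`exists_incrementCov_bound`). If `H < 1/2`, increments over different cells are
nonpositively correlated, so only the diagonal counts and the second moment is `O(Δ ^ (2 * H + 1))`.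
If `1/2 ≤ H`, all covariances are nonnegative and increase with the intervals. Full cells therefore
dominate, their covariances telescope to the variance of `B_{t_n}`, and the second moment is `O(Δ ^
2)`.

The case `Δ > 1` concerns finitely many `N` and is absorbed into the constant. -/

lemma timeStep_nonneg {T : ℝ} (hT : 0 ≤ T) (N : ℕ) : 0 ≤ timeStep T N := by
  unfold timeStep; positivity

lemma timeStep_pos {T : ℝ} (hT : 0 < T) {N : ℕ} (hN : 1 ≤ N) : 0 < timeStep T N := by
  unfold timeStep; positivity

lemma natCast_mul_timeStep (T : ℝ) {N : ℕ} (hN : 1 ≤ N) : (N : ℝ) * timeStep T N = T := by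
  have : (N : ℝ) ≠ 0 := by positivity
  unfold timeStep; field_simp

lemma meshPoint_zero (T : ℝ) (N : ℕ) : meshPoint T N 0 = 0 := by simp [meshPoint]

lemma meshPoint_succ_sub (T : ℝ) (N i : ℕ) :
    meshPoint T N (i + 1) - meshPoint T N i = timeStep T N := by
  simp only [meshPoint]; push_cast; ring

lemma monotone_meshPoint {T : ℝ} (hT : 0 ≤ T) (N : ℕ) : Monotone (meshPoint T N) :=
  monotone_nat_of_le_succ fun i => by
    linarith [meshPoint_succ_sub T N i, timeStep_nonneg hT N]

lemma meshPoint_nonneg {T : ℝ} (hT : 0 ≤ T) (N i : ℕ) : 0 ≤ meshPoint T N i :=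
  meshPoint_zero T N ▸ monotone_meshPoint hT N i.zero_le

lemma meshPoint_le {T : ℝ} (hT : 0 ≤ T) {N n : ℕ} (hN : 1 ≤ N) (hn : n ≤ N) :
    meshPoint T N n ≤ T :=
  (monotone_meshPoint hT N hn).trans_eq (natCast_mul_timeStep T hN)

/-! ### Covariances of increments: sign, monotonicity, telescoping. -/

/-- The covariance `E[(B_s - B_a) (B_r - B_b)]` of two increments of a fractional Brownian
motion. -/
noncomputable def incrementCov (H σ a s b r : ℝ) : ℝ :=
  σ ^ 2 / 2 * (|r - a| ^ (2 * H) + |b - s| ^ (2 * H) - |r - s| ^ (2 * H) - |b - a| ^ (2 * H))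

lemma incrementCov_comm (H σ a s b r : ℝ) :
    incrementCov H σ a s b r = incrementCov H σ b r a s := by
  simp only [incrementCov]
  rw [abs_sub_comm r a, abs_sub_comm b s, abs_sub_comm r s, abs_sub_comm b a]
  ring

lemma incrementCov_add_left (H σ a s t b r : ℝ) :
    incrementCov H σ a s b r + incrementCov H σ s t b r = incrementCov H σ a t b r := by
  simp only [incrementCov]
  ring

lemma incrementCov_add_right (H σ a s b r t : ℝ) :
    incrementCov H σ a s b r + incrementCov H σ a s r t = incrementCov H σ a s b t := by
  simp only [incrementCov]
  ring

lemma incrementCov_self (H σ a s : ℝ) (hH : 0 < H) :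
    incrementCov H σ a s a s = σ ^ 2 * |s - a| ^ (2 * H) := by
  have h : (0 : ℝ) ^ (2 * H) = 0 := Real.zero_rpow (by positivity)
  simp only [incrementCov, sub_self, abs_zero, h, abs_sub_comm a s]
  ring

/-- Both inner points are convex combinations of `x` and `x + u + v`, with weights `u / (u + v)` and
`v / (u + v)` in opposite order; add the two convexity inequalities. -/
lemma ConvexOn.map_add_map_add_le {g : ℝ → ℝ} (hg : ConvexOn ℝ (Set.Ici 0) g) {x u v : ℝ}
    (hx : 0 ≤ x) (hu : 0 ≤ u) (hv : 0 ≤ v) :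
    g (x + u) + g (x + v) ≤ g (x + u + v) + g x := by
  rcases (add_nonneg hu hv).eq_or_lt with h | h
  · obtain rfl : u = 0 := by linarith
    obtain rfl : v = 0 := by linarith
    simp
  · have h1 : u / (u + v) + v / (u + v) = 1 := by field_simp
    have hm : x + u + v ∈ Set.Ici (0 : ℝ) := by simp only [Set.mem_Ici]; linarith
    have e1 := hg.2 hm (Set.mem_Ici.2 hx) (by positivity : 0 ≤ u / (u + v))
      (by positivity : 0 ≤ v / (u + v)) h1
    have e2 := hg.2 hm (Set.mem_Ici.2 hx) (by positivity : 0 ≤ v / (u + v))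
      (by positivity : 0 ≤ u / (u + v)) (by linarith)
    have r1 : (u / (u + v)) • (x + u + v) + (v / (u + v)) • x = x + u := by
      simp only [smul_eq_mul]; field_simp; ring
    have r2 : (v / (u + v)) • (x + u + v) + (u / (u + v)) • x = x + v := by
      simp only [smul_eq_mul]; field_simp; ring
    rw [r1] at e1
    rw [r2] at e2
    simp only [smul_eq_mul] at e1 e2
    have : (u / (u + v)) * g (x + u + v) + (v / (u + v)) * g (x + u + v) = g (x + u + v) := by
      rw [← add_mul, h1, one_mul]
    have : (u / (u + v)) * g x + (v / (u + v)) * g x = g x := by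
      rw [← add_mul, h1, one_mul]
    linarith

/-- For ordered intervals the covariance is a mixed second difference of `τ ^ (2 * H)`, which is
convex here and concave in the next lemma. -/
lemma incrementCov_nonneg_of_le {H σ a s b r : ℝ} (hH : 1 / 2 ≤ H) (has : a ≤ s) (hsb : s ≤ b)
    (hbr : b ≤ r) : 0 ≤ incrementCov H σ a s b r := by
  have h := (convexOn_rpow (p := 2 * H) (by linarith)).map_add_map_add_le
    (sub_nonneg.2 hsb) (sub_nonneg.2 has) (sub_nonneg.2 hbr)
  rw [incrementCov, abs_of_nonneg (by linarith : 0 ≤ r - a), abs_of_nonneg (sub_nonneg.2 hsb),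
    abs_of_nonneg (by linarith : 0 ≤ r - s), abs_of_nonneg (by linarith : 0 ≤ b - a)]
  rw [show b - s + (s - a) = b - a by ring, show b - s + (r - b) = r - s by ring,
    show b - a + (r - b) = r - a by ring] at h
  exact mul_nonneg (by positivity) (by linarith)

lemma incrementCov_nonpos_of_le {H σ a s b r : ℝ} (hH0 : 0 < H) (hH : H ≤ 1 / 2) (has : a ≤ s)
    (hsb : s ≤ b) (hbr : b ≤ r) : incrementCov H σ a s b r ≤ 0 := by
  have h := (Real.concaveOn_rpow (p := 2 * H) (by linarith) (by linarith)).neg.map_add_map_add_le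
    (sub_nonneg.2 hsb) (sub_nonneg.2 has) (sub_nonneg.2 hbr)
  rw [incrementCov, abs_of_nonneg (by linarith : 0 ≤ r - a), abs_of_nonneg (sub_nonneg.2 hsb),
    abs_of_nonneg (by linarith : 0 ≤ r - s), abs_of_nonneg (by linarith : 0 ≤ b - a)]
  rw [show b - s + (s - a) = b - a by ring, show b - s + (r - b) = r - s by ring,
    show b - a + (r - b) = r - a by ring] at h
  simp only [Pi.neg_apply] at h
  exact mul_nonpos_of_nonneg_of_nonpos (by positivity) (by linarith)

/-- By additivity, enlarging either interval adds the covariance of two ordered intervals, which is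
nonnegative. -/
lemma incrementCov_mono {H σ a s s' b r r' : ℝ} (hH : 1 / 2 ≤ H) (has : a ≤ s) (hs : s ≤ s')
    (hsb : s' ≤ b) (hbr : b ≤ r) (hr : r ≤ r') :
    incrementCov H σ a s b r ≤ incrementCov H σ a s' b r' := by
  have h1 := incrementCov_nonneg_of_le (σ := σ) hH hs hsb (hbr.trans hr)
  have h2 := incrementCov_nonneg_of_le (σ := σ) hH has (hs.trans (hsb.trans hbr)) hr
  linarith [incrementCov_add_left H σ a s s' b r', incrementCov_add_right H σ a s b r r']

lemma incrementCov_same_le {H σ a c s r : ℝ} (hH : 0 < H) (hs : s ∈ Set.Icc a c)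
    (hr : r ∈ Set.Icc a c) : incrementCov H σ a s a r ≤ σ ^ 2 * |c - a| ^ (2 * H) := by
  have key : ∀ x ∈ Set.Icc a c, |x - a| ^ (2 * H) ≤ |c - a| ^ (2 * H) := fun x hx =>
    Real.rpow_le_rpow (abs_nonneg _)
      (by rw [abs_of_nonneg (by linarith [hx.1]), abs_of_nonneg (by linarith [hx.1, hx.2])]
          linarith [hx.2]) (by linarith)
  have h : (0 : ℝ) ^ (2 * H) = 0 := Real.zero_rpow (by positivity)
  have h1 := key s hs
  have h2 := key r hr
  have h3 : 0 ≤ |r - s| ^ (2 * H) := Real.rpow_nonneg (abs_nonneg _) _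
  simp only [incrementCov, sub_self, abs_zero, h, abs_sub_comm a s]
  have : 0 ≤ σ ^ 2 := by positivity
  nlinarith

/-- Telescoping in each argument leaves the variance of the total increment. -/
lemma sum_sum_incrementCov (H σ : ℝ) (hH : 0 < H) (t : ℕ → ℝ) (n : ℕ) :
    ∑ i ∈ Finset.range n, ∑ j ∈ Finset.range n,
      incrementCov H σ (t i) (t (i + 1)) (t j) (t (j + 1)) =
      σ ^ 2 * |t n - t 0| ^ (2 * H) := by
  have hr : ∀ a s, ∀ m : ℕ, ∑ j ∈ Finset.range m, incrementCov H σ a s (t j) (t (j + 1)) =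
      incrementCov H σ a s (t 0) (t m) := by
    intro a s m
    induction m with
    | zero => simp [incrementCov]
    | succ m ih => rw [Finset.sum_range_succ, ih, incrementCov_add_right]
  have hl : ∀ b r, ∀ m : ℕ, ∑ j ∈ Finset.range m, incrementCov H σ (t j) (t (j + 1)) b r =
      incrementCov H σ (t 0) (t m) b r := by
    intro b r m
    simp_rw [incrementCov_comm H σ _ _ b r]
    exact hr b r m
  simp_rw [hr]
  rw [hl, incrementCov_self _ _ _ _ hH]

/-- Upper bounds `K i j` for the covariances of increments of a fractional Brownian motion over
initial pieces of the `i`-th and `j`-th cells of a uniform mesh, with small total mass. -/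
lemma exists_incrementCov_bound {H σ T : ℝ} (hH0 : 0 < H) (hT : 0 ≤ T) (N : ℕ) (hN : 1 ≤ N) :
    ∃ K : ℕ → ℕ → ℝ, (∀ i j, 0 ≤ K i j) ∧
      (∀ i j, ∀ s ∈ Set.Icc (meshPoint T N i) (meshPoint T N (i + 1)),
        ∀ r ∈ Set.Icc (meshPoint T N j) (meshPoint T N (j + 1)),
        incrementCov H σ (meshPoint T N i) s (meshPoint T N j) r ≤ K i j) ∧
      ∀ n ≤ N, ∑ i ∈ Finset.range n, ∑ j ∈ Finset.range n, K i j ≤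
        if H < 1 / 2 then σ ^ 2 * T * timeStep T N ^ (2 * H - 1) else σ ^ 2 * T ^ (2 * H) := by
  have hΔ : 0 ≤ timeStep T N := timeStep_nonneg hT N
  have hNΔ : (N : ℝ) * timeStep T N = T := natCast_mul_timeStep T hN
  have hstep : ∀ i, meshPoint T N (i + 1) - meshPoint T N i = timeStep T N :=
    meshPoint_succ_sub T N
  have hmono : Monotone (meshPoint T N) := monotone_meshPoint hT N
  split_ifs with hH
  -- Off the diagonal the covariances are nonpositive, so `0` bounds them.
  · refine ⟨fun i j => if i = j then σ ^ 2 * timeStep T N ^ (2 * H) else 0, fun i j => ?_,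
      fun i j s hs r hr => ?_, fun n hn => ?_⟩
    · beta_reduce
      split_ifs
      · positivity
      · exact le_rfl
    · beta_reduce
      rcases lt_trichotomy i j with h | rfl | h
      · rw [if_neg h.ne]
        exact incrementCov_nonpos_of_le hH0 hH.le hs.1 (hs.2.trans (hmono h)) hr.1
      · rw [if_pos rfl]
        refine (incrementCov_same_le hH0 hs hr).trans ?_
        rw [hstep, abs_of_nonneg hΔ]
      · rw [if_neg h.ne', incrementCov_comm]
        exact incrementCov_nonpos_of_le hH0 hH.le hr.1 (hr.2.trans (hmono h)) hs.1
    · have : ∑ i ∈ Finset.range n, ∑ j ∈ Finset.range n,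
          (if i = j then σ ^ 2 * timeStep T N ^ (2 * H) else 0) =
          n * (σ ^ 2 * timeStep T N ^ (2 * H)) := by
        rw [Finset.sum_congr rfl (g := fun _ => σ ^ 2 * timeStep T N ^ (2 * H))]
        · simp
        · intro i hi
          rw [Finset.sum_ite_eq, if_pos hi]
      rw [this]
      rcases hΔ.eq_or_lt with h0 | h0
      · rw [← h0, Real.zero_rpow (by positivity), ← hNΔ, ← h0]; simp
      · have e : timeStep T N ^ (2 * H) = timeStep T N * timeStep T N ^ (2 * H - 1) := by
          rw [Real.rpow_sub_one h0.ne']; field_simp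
        rw [e]
        calc (n : ℝ) * (σ ^ 2 * (timeStep T N * timeStep T N ^ (2 * H - 1)))
            ≤ N * (σ ^ 2 * (timeStep T N * timeStep T N ^ (2 * H - 1))) := by gcongr
          _ = σ ^ 2 * (N * timeStep T N) * timeStep T N ^ (2 * H - 1) := by ring
          _ = _ := by rw [hNΔ]
  · push Not at hH
    have hle : ∀ i, meshPoint T N i ≤ meshPoint T N (i + 1) := fun i => hmono i.le_succ
    have hself : ∀ i, incrementCov H σ (meshPoint T N i) (meshPoint T N (i + 1))
        (meshPoint T N i) (meshPoint T N (i + 1)) =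
        σ ^ 2 * |meshPoint T N (i + 1) - meshPoint T N i| ^ (2 * H) := fun i =>
      incrementCov_self _ _ _ _ hH0
    -- Covariances over initial pieces of cells are at most those over the full cells.
    refine ⟨fun i j => incrementCov H σ (meshPoint T N i) (meshPoint T N (i + 1))
      (meshPoint T N j) (meshPoint T N (j + 1)), fun i j => ?_,
      fun i j s hs r hr => ?_, fun n hn => ?_⟩
    · beta_reduce
      rcases lt_trichotomy i j with h | rfl | h
      · exact incrementCov_nonneg_of_le hH (hle i) (hmono h) (hle j)
      · rw [hself]; positivity
      · rw [incrementCov_comm]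
        exact incrementCov_nonneg_of_le hH (hle j) (hmono h) (hle i)
    · beta_reduce
      rcases lt_trichotomy i j with h | rfl | h
      · exact incrementCov_mono hH hs.1 hs.2 (hmono h) hr.1 hr.2
      · rw [hself]
        exact incrementCov_same_le hH0 hs hr
      · rw [incrementCov_comm, incrementCov_comm H σ (meshPoint T N i) (meshPoint T N (i + 1))]
        exact incrementCov_mono hH hr.1 hr.2 (hmono h) hs.1 hs.2
    · rw [sum_sum_incrementCov _ _ hH0]
      have hn' : meshPoint T N n ≤ T := meshPoint_le hT hN hn
      have hn0 : 0 ≤ meshPoint T N n := meshPoint_nonneg hT N n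
      rw [meshPoint_zero, sub_zero, abs_of_nonneg hn0]
      gcongr

/-! ### Pathwise error analysis. -/

/-- Unroll the recursion. The weights of `R` are bounded by `1`, while the `D` sum is kept exact so
that its cancellation survives. -/
lemma abs_sub_sum_le_of_recursion {e R D : ℕ → ℝ} {q : ℝ} (hq0 : 0 ≤ q) (hq1 : q ≤ 1)
    (h0 : e 0 = 0) {N : ℕ} (h : ∀ j < N, e (j + 1) = q * e j + R j + D j) :
    ∀ n ≤ N, |e n - ∑ j ∈ Finset.range n, q ^ (n - 1 - j) * D j| ≤
      ∑ j ∈ Finset.range n, |R j| := by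
  intro n
  induction n with
  | zero => simp [h0]
  | succ n ih =>
    intro hn
    have hJ : ∑ j ∈ Finset.range (n + 1), q ^ (n + 1 - 1 - j) * D j =
        q * ∑ j ∈ Finset.range n, q ^ (n - 1 - j) * D j + D n := by
      rw [Finset.sum_range_succ, Finset.mul_sum]
      congr 1
      · refine Finset.sum_congr rfl fun j hj => ?_
        rw [show n + 1 - 1 - j = (n - 1 - j) + 1 by have := Finset.mem_range.1 hj; omega, pow_succ]
        ring
      · simp
    rw [hJ, h n (by omega), Finset.sum_range_succ]
    have h1 := ih (by omega)
    set S := ∑ j ∈ Finset.range n, q ^ (n - 1 - j) * D j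
    calc |q * e n + R n + D n - (q * S + D n)| = |q * (e n - S) + R n| := by ring_nf
      _ ≤ |q * (e n - S)| + |R n| := abs_add_le _ _
      _ = q * |e n - S| + |R n| := by rw [abs_mul, abs_of_nonneg hq0]
      _ ≤ 1 * |e n - S| + |R n| := by gcongr
      _ ≤ _ := by linarith

section Path

variable {x b : ℝ → ℝ} {x₀ T : ℝ}

lemma linearODE_continuousOn (hT : 0 ≤ T)
    (hint : IntervalIntegrable (fun s => -x s + b s) volume 0 T)
    (hx : ∀ t ∈ Set.Icc (0 : ℝ) T, x t = x₀ + ∫ s in (0 : ℝ)..t, (-x s + b s)) :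
    ContinuousOn x (Set.Icc 0 T) := by
  have h := intervalIntegral.continuousOn_primitive_interval' hint Set.left_mem_uIcc
  rw [Set.uIcc_of_le hT] at h
  exact (continuousOn_const.add h).congr hx

/-- Integrating factor `exp s`. Besides the bound below, this formula supplies the measurability of
`X t`. -/
lemma linearODE_eq (hb : Continuous b) (hT : 0 ≤ T)
    (hint : IntervalIntegrable (fun s => -x s + b s) volume 0 T)
    (hx : ∀ t ∈ Set.Icc (0 : ℝ) T, x t = x₀ + ∫ s in (0 : ℝ)..t, (-x s + b s)) {t : ℝ}
    (ht : t ∈ Set.Icc 0 T) :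
    x t = Real.exp (-t) * (x₀ + ∫ s in (0 : ℝ)..t, Real.exp s * b s) := by
  have hc := linearODE_continuousOn hT hint hx
  have hcf : ContinuousOn (fun s => -x s + b s) (Set.Icc 0 T) := hc.neg.add hb.continuousOn
  have hd : ∀ s ∈ Set.Ioo 0 t, HasDerivAt x (-x s + b s) s := by
    intro s hs
    have hsT : s ∈ Set.Ioo 0 T := ⟨hs.1, hs.2.trans_le ht.2⟩
    have hn : Set.Icc 0 T ∈ nhds s := Icc_mem_nhds hsT.1 hsT.2
    have h1 : HasDerivAt (fun u => ∫ r in (0 : ℝ)..u, (-x r + b r)) (-x s + b s) s := by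
      refine intervalIntegral.integral_hasDerivAt_right
        (hint.mono_set (by rw [Set.uIcc_of_le hsT.1.le, Set.uIcc_of_le hT]
                           exact Set.Icc_subset_Icc_right hsT.2.le)) ?_ (hcf.continuousAt hn)
      exact ⟨_, hn, hcf.aestronglyMeasurable measurableSet_Icc⟩
    refine (h1.const_add x₀).congr_of_eventuallyEq ?_
    filter_upwards [hn] with u hu using hx u hu
  have hF : ∫ s in (0 : ℝ)..t, Real.exp s * b s = Real.exp t * x t - Real.exp 0 * x 0 := by
    refine intervalIntegral.integral_eq_sub_of_hasDerivAt_of_le ht.1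
      (Real.continuous_exp.continuousOn.mul (hc.mono (Set.Icc_subset_Icc_right ht.2)))
      (fun s hs => ?_) ((Real.continuous_exp.mul hb).intervalIntegrable _ _)
    exact ((Real.hasDerivAt_exp s).mul (hd s hs)).congr_deriv (by ring)
  have h0 : x 0 = x₀ := by simpa using hx 0 ⟨le_rfl, hT⟩
  rw [hF, h0, Real.exp_zero, one_mul, add_sub_cancel, ← mul_assoc, ← Real.exp_add]
  simp

/-- In the explicit formula `exp s ≤ exp t`, which the prefactor `exp (-t)` cancels. -/
lemma linearODE_abs_le (hb : Continuous b) (hT : 0 ≤ T)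
    (hint : IntervalIntegrable (fun s => -x s + b s) volume 0 T)
    (hx : ∀ t ∈ Set.Icc (0 : ℝ) T, x t = x₀ + ∫ s in (0 : ℝ)..t, (-x s + b s)) {t : ℝ}
    (ht : t ∈ Set.Icc 0 T) : |x t| ≤ |x₀| + ∫ s in (0 : ℝ)..T, |b s| := by
  rw [linearODE_eq hb hT hint hx ht, abs_mul, abs_of_pos (Real.exp_pos _)]
  have hbi : ∀ u v, IntervalIntegrable (fun s => |b s|) volume u v :=
    fun u v => hb.abs.intervalIntegrable u v
  have h1 : |∫ s in (0 : ℝ)..t, Real.exp s * b s| ≤ Real.exp t * ∫ s in (0 : ℝ)..t, |b s| := by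
    rw [← intervalIntegral.integral_const_mul]
    refine (intervalIntegral.abs_integral_le_integral_abs ht.1).trans ?_
    refine intervalIntegral.integral_mono_on ht.1
      ((Real.continuous_exp.mul hb).abs.intervalIntegrable _ _) ((hbi 0 t).const_mul _)
      fun s hs => ?_
    rw [abs_mul, abs_of_pos (Real.exp_pos _)]
    gcongr
    exact hs.2
  have h2 : ∫ s in (0 : ℝ)..t, |b s| ≤ ∫ s in (0 : ℝ)..T, |b s| :=
    intervalIntegral.integral_mono_interval le_rfl ht.1 ht.2
      (Filter.Eventually.of_forall fun _ => abs_nonneg _) (hbi 0 T)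
  have h3 : Real.exp (-t) * Real.exp t = 1 := by rw [← Real.exp_add]; simp
  have h4 : Real.exp (-t) ≤ 1 := Real.exp_le_one_iff.2 (by linarith [ht.1])
  calc Real.exp (-t) * |x₀ + ∫ s in (0 : ℝ)..t, Real.exp s * b s|
      ≤ Real.exp (-t) * (|x₀| + Real.exp t * ∫ s in (0 : ℝ)..t, |b s|) := by
        gcongr
        exact (abs_add_le _ _).trans (by gcongr)
    _ = Real.exp (-t) * |x₀| + ∫ s in (0 : ℝ)..t, |b s| := by
        rw [mul_add, ← mul_assoc, h3, one_mul]
    _ ≤ 1 * |x₀| + ∫ s in (0 : ℝ)..T, |b s| := by gcongr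
    _ = _ := by rw [one_mul]

/-- Pathwise bound of the Euler error by a first order term and a weighted sum of the local
errors of the driving path. -/
lemma linearODE_euler_error_le (hb : Continuous b) (hT : 0 ≤ T)
    (hint : IntervalIntegrable (fun s => -x s + b s) volume 0 T)
    (hx : ∀ t ∈ Set.Icc (0 : ℝ) T, x t = x₀ + ∫ s in (0 : ℝ)..t, (-x s + b s)) {N : ℕ}
    (hN : 1 ≤ N) (hΔ : timeStep T N ≤ 1) {y : ℕ → ℝ} (hy0 : y 0 = x₀)
    (hy : ∀ j, y (j + 1) = y j + timeStep T N * (-y j + b (meshPoint T N j))) {n : ℕ}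
    (hn : n ≤ N) :
    |x (meshPoint T N n) - y n| ≤
      timeStep T N * ((T + 1) * (|x₀| + ∫ s in (0 : ℝ)..T, |b s|)) +
      |∑ j ∈ Finset.range n, (1 - timeStep T N) ^ (n - 1 - j) *
        ∫ s in (meshPoint T N j)..(meshPoint T N (j + 1)), (b s - b (meshPoint T N j))| := by
  set M := |x₀| + ∫ s in (0 : ℝ)..T, |b s| with hM
  set Δ := timeStep T N with hΔdef
  set t := meshPoint T N with ht
  have hΔ0 : 0 ≤ Δ := timeStep_nonneg hT N
  have hmono : Monotone t := monotone_meshPoint hT N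
  have hstep : ∀ i, t (i + 1) - t i = Δ := meshPoint_succ_sub T N
  have hmem : ∀ j ≤ N, t j ∈ Set.Icc 0 T := fun j hj =>
    ⟨meshPoint_nonneg hT N j, meshPoint_le hT hN hj⟩
  have hc := linearODE_continuousOn hT hint hx
  have hxi : ∀ u ∈ Set.Icc 0 T, ∀ v ∈ Set.Icc 0 T, IntervalIntegrable x volume u v :=
    fun u hu v hv => (hc.mono (Set.uIcc_subset_Icc hu hv)).intervalIntegrable
  have hbi : ∀ u v, IntervalIntegrable b volume u v := fun u v => hb.intervalIntegrable u v
  have hbi' : ∀ u v, IntervalIntegrable (fun s => |b s|) volume u v :=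
    fun u v => hb.abs.intervalIntegrable u v
  have hni : ∀ u ∈ Set.Icc 0 T, ∀ v ∈ Set.Icc 0 T,
      IntervalIntegrable (fun s => -x s) volume u v := fun u hu v hv => (hxi u hu v hv).neg
  have hdiff : ∀ u ∈ Set.Icc 0 T, ∀ v ∈ Set.Icc 0 T,
      x v - x u = ∫ s in u..v, (-x s + b s) := fun u hu v hv => by
    have h0 : (0 : ℝ) ∈ Set.Icc 0 T := ⟨le_rfl, hT⟩
    rw [hx u hu, hx v hv, add_sub_add_left_eq_sub,
      intervalIntegral.integral_interval_sub_left ((hni 0 h0 v hv).add (hbi _ _))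
        ((hni 0 h0 u hu).add (hbi _ _))]
  set R : ℕ → ℝ := fun j => ∫ s in (t j)..(t (j + 1)), (x (t j) - x s) with hR
  set D : ℕ → ℝ := fun j => ∫ s in (t j)..(t (j + 1)), (b s - b (t j)) with hD
  have hrec : ∀ j < N, x (t (j + 1)) - y (j + 1) =
      (1 - Δ) * (x (t j) - y j) + R j + D j := by
    intro j hj
    have hj0 := hmem j hj.le
    have hj1 := hmem (j + 1) hj
    have e1 := hdiff _ hj0 _ hj1
    rw [intervalIntegral.integral_add (hni _ hj0 _ hj1) (hbi _ _),
      intervalIntegral.integral_neg] at e1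
    have e2 : R j = Δ * x (t j) - ∫ s in (t j)..(t (j + 1)), x s := by
      simp only [hR]
      rw [intervalIntegral.integral_sub intervalIntegrable_const (hxi _ hj0 _ hj1),
        intervalIntegral.integral_const, hstep, smul_eq_mul]
    have e3 : D j = (∫ s in (t j)..(t (j + 1)), b s) - Δ * b (t j) := by
      simp only [hD]
      rw [intervalIntegral.integral_sub (hbi _ _) intervalIntegrable_const,
        intervalIntegral.integral_const, hstep, smul_eq_mul]
    rw [e2, e3, hy j]
    linear_combination e1
  -- Within a cell, `x` moves by at most the integral of `|-x + b|`, and `|x| ≤ M`; integrating over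
  -- the cell gives another factor `Δ`.
  have hRle : ∀ j < N, |R j| ≤ Δ * (Δ * M + ∫ s in (t j)..(t (j + 1)), |b s|) := by
    intro j hj
    have hj0 := hmem j hj.le
    have hj1 := hmem (j + 1) hj
    have hle : t j ≤ t (j + 1) := hmono j.le_succ
    have key : ∀ s ∈ Set.uIoc (t j) (t (j + 1)), ‖x (t j) - x s‖ ≤
        Δ * M + ∫ s in (t j)..(t (j + 1)), |b s| := by
      intro s hs
      rw [Set.uIoc_of_le hle] at hs
      have hs' : s ∈ Set.Icc 0 T := ⟨hj0.1.trans hs.1.le, hs.2.trans hj1.2⟩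
      rw [Real.norm_eq_abs, abs_sub_comm, hdiff _ hj0 _ hs']
      refine (intervalIntegral.abs_integral_le_integral_abs hs.1.le).trans ?_
      have hi := (hni _ hj0 _ hj1).add (hbi (t j) (t (j + 1)))
      calc ∫ u in (t j)..s, |-x u + b u| ≤ ∫ u in (t j)..(t (j + 1)), |-x u + b u| :=
            intervalIntegral.integral_mono_interval le_rfl hs.1.le hs.2
              (Filter.Eventually.of_forall fun _ => abs_nonneg _) hi.abs
        _ ≤ ∫ u in (t j)..(t (j + 1)), (M + |b u|) := by
            refine intervalIntegral.integral_mono_on hle hi.abs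
              (intervalIntegrable_const.add (hbi' _ _)) fun u hu => ?_
            refine (abs_add_le _ _).trans ?_
            rw [abs_neg]
            gcongr
            exact linearODE_abs_le hb hT hint hx ⟨hj0.1.trans hu.1, hu.2.trans hj1.2⟩
        _ = _ := by
            rw [intervalIntegral.integral_add intervalIntegrable_const (hbi' _ _),
              intervalIntegral.integral_const, hstep, smul_eq_mul]
    have := intervalIntegral.norm_integral_le_of_norm_le_const key
    rw [hstep, abs_of_nonneg hΔ0, Real.norm_eq_abs] at this
    rwa [mul_comm Δ]
  have hsum : ∑ j ∈ Finset.range n, |R j| ≤ Δ * ((T + 1) * M) := by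
    have hM0 : 0 ≤ M := add_nonneg (abs_nonneg _)
      (intervalIntegral.integral_nonneg hT fun _ _ => abs_nonneg _)
    calc ∑ j ∈ Finset.range n, |R j|
        ≤ ∑ j ∈ Finset.range n, Δ * (Δ * M + ∫ s in (t j)..(t (j + 1)), |b s|) :=
          Finset.sum_le_sum fun j hj => hRle j ((Finset.mem_range.1 hj).trans_le hn)
      _ = Δ * (t n * M + ∫ s in (0 : ℝ)..(t n), |b s|) := by
          rw [← Finset.mul_sum, Finset.sum_add_distrib,
            intervalIntegral.sum_integral_adjacent_intervals fun k _ => hbi' _ _,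
            ht, meshPoint_zero]
          simp only [Finset.sum_const, Finset.card_range, nsmul_eq_mul, meshPoint]
          ring
      _ ≤ Δ * (T * M + M) := by
          have h2 : ∫ s in (0 : ℝ)..(t n), |b s| ≤ ∫ s in (0 : ℝ)..T, |b s| :=
            intervalIntegral.integral_mono_interval le_rfl (hmem n hn).1 (hmem n hn).2
              (Filter.Eventually.of_forall fun _ => abs_nonneg _) (hbi' 0 T)
          gcongr
          · exact (hmem n hn).2
          · exact h2.trans (le_add_of_nonneg_left (abs_nonneg _))
      _ = _ := by ring
  have h0 : x (t 0) - y 0 = 0 := by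
    rw [hy0, ht, meshPoint_zero, hx 0 ⟨le_rfl, hT⟩]; simp
  have := abs_sub_sum_le_of_recursion (e := fun j => x (t j) - y j) (q := 1 - Δ) (R := R) (D := D)
    (by linarith) (by linarith) h0 hrec n hn
  have h3 := abs_sub_abs_le_abs_sub (x (t n) - y n)
    (∑ j ∈ Finset.range n, (1 - Δ) ^ (n - 1 - j) * D j)
  linarith

end Path

/-! ### Square-integrable processes: Cauchy–Schwarz, Fubini, joint measurability. -/

section General

variable {α Ω : Type*} [MeasurableSpace α] [MeasurableSpace Ω] {μ : Measure α} [IsFiniteMeasure μ]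
  {P : Measure Ω}

/-- Expand `0 ≤ ∫ (m * f - I) ^ 2`, with `m` the total mass and `I` the integral, and divide by `m`.
-/
lemma sq_integral_le_measureReal_mul_integral_sq {f : α → ℝ} (hf : MemLp f 2 μ) :
    (∫ x, f x ∂μ) ^ 2 ≤ μ.real Set.univ * ∫ x, f x ^ 2 ∂μ := by
  set m := μ.real Set.univ with hm
  set I := ∫ x, f x ∂μ with hI
  have hm0 : 0 ≤ m := measureReal_nonneg
  rcases hm0.eq_or_lt with h | h
  · have : μ = 0 := by
      rw [← Measure.measure_univ_eq_zero]
      exact (measureReal_eq_zero_iff (by finiteness)).1 (hm.symm.trans h.symm)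
    rw [hI, this]; simp
  · have hf1 : Integrable f μ := hf.integrable one_le_two
    have hf2 : Integrable (fun x => f x ^ 2) μ := hf.integrable_sq
    have h0 : 0 ≤ ∫ x, (m * f x - I) ^ 2 ∂μ := integral_nonneg fun _ => sq_nonneg _
    have e : ∫ x, (m * f x - I) ^ 2 ∂μ = m * (m * ∫ x, f x ^ 2 ∂μ - I ^ 2) := by
      have : ∀ x, (m * f x - I) ^ 2 = m ^ 2 * f x ^ 2 - 2 * m * I * f x + I ^ 2 := fun x => by ring
      simp_rw [this]
      have hd : Integrable (fun x => m ^ 2 * f x ^ 2 - 2 * m * I * f x) μ :=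
        (hf2.const_mul _).sub (hf1.const_mul _)
      rw [integral_add hd (integrable_const _), integral_sub (hf2.const_mul _) (hf1.const_mul _),
        integral_const_mul, integral_const_mul,
        integral_const, smul_eq_mul, ← hI, ← hm]
      ring
    rw [e] at h0
    linarith [nonneg_of_mul_nonneg_right h0 h]

lemma MeasureTheory.MemLp.two_integral_prod [SFinite P] {Y : α → Ω → ℝ}
    (hY : MemLp (Function.uncurry Y) 2 (μ.prod P)) :
    MemLp (fun ω => ∫ s, Y s ω ∂μ) 2 P := by
  have hsq : Integrable (fun p : α × Ω => Function.uncurry Y p ^ 2) (μ.prod P) := hY.integrable_sq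
  have hm : AEStronglyMeasurable (fun ω => ∫ s, Y s ω ∂μ) P :=
    hY.1.prod_swap.integral_prod_right'
  rw [memLp_two_iff_integrable_sq hm]
  refine (hsq.integral_prod_right.const_mul (μ.real Set.univ)).mono' (hm.pow 2) ?_
  filter_upwards [hsq.prod_left_ae, hY.1.prod_swap.prodMk_left] with ω h1 h2
  rw [Real.norm_eq_abs, abs_of_nonneg (sq_nonneg _)]
  exact sq_integral_le_measureReal_mul_integral_sq ((memLp_two_iff_integrable_sq h2).2 h1)

/-- Fubini. The bound is one-sided, so that negative correlations can be discarded. -/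
lemma integral_mul_integral_le_of_memLp [SFinite P] {Z : Ω → ℝ} (hZ : MemLp Z 2 P)
    {Y : α → Ω → ℝ} (hY : MemLp (Function.uncurry Y) 2 (μ.prod P)) {K : ℝ}
    (hK : ∀ᵐ s ∂μ, ∫ ω, Z ω * Y s ω ∂P ≤ K) :
    ∫ ω, Z ω * ∫ s, Y s ω ∂μ ∂P ≤ μ.real Set.univ * K := by
  have hint : Integrable (fun p : α × Ω => Z p.2 * Y p.1 p.2) (μ.prod P) :=
    (hZ.comp_snd μ).integrable_mul hY
  simp_rw [← integral_const_mul]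
  rw [← integral_integral_swap hint]
  calc ∫ s, ∫ ω, Z ω * Y s ω ∂P ∂μ ≤ ∫ _, K ∂μ :=
        integral_mono_ae hint.integral_prod_left (integrable_const _) hK
    _ = _ := by rw [integral_const, smul_eq_mul]

lemma Measurable.eval_natIndexed {β : Type*} [MeasurableSpace β] {g : ℕ → Ω → ℝ} {k : β → ℕ}
    {π : β → Ω} (hk : Measurable k) (hπ : Measurable π) (hg : ∀ n, Measurable (g n)) :
    Measurable fun p => g (k p) (π p) :=
  (measurable_from_prod_countable_left (f := fun p : Ω × ℕ => g p.2 p.1) hg).comp (hπ.prodMk hk)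

/-- A process on `[0, ∞)` with almost surely continuous paths is jointly measurable up to a null
set. -/
lemma aestronglyMeasurable_uncurry_of_ae_continuous [SFinite P] {B : ℝ≥0 → Ω → ℝ}
    (hB : ∀ t, AEMeasurable (B t) P) (hc : ∀ᵐ ω ∂P, Continuous fun t => B t ω)
    (μ : Measure ℝ) [SFinite μ] :
    AEStronglyMeasurable (fun p : ℝ × Ω => B p.1.toNNReal p.2) (μ.prod P) := by
  -- Sample the path at `⌊t * (n + 1)⌋ / (n + 1)`, which tends to `t`. Only countably many times
  -- occur, so measurable versions agree with `B` there off a single null set.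
  let q : ℕ → ℕ → ℝ≥0 := fun n k => k / (n + 1)
  let B' : ℝ≥0 → Ω → ℝ := fun t => (hB t).mk
  let f : ℕ → ℝ × Ω → ℝ := fun n p => B' (q n ⌊p.1.toNNReal * (n + 1)⌋₊) p.2
  have hf : ∀ n, Measurable (f n) := fun n => by
    have h2 : Measurable fun p : ℝ × Ω => ⌊p.1.toNNReal * (n + 1)⌋₊ :=
      Nat.measurable_floor.comp (measurable_fst.real_toNNReal.mul_const _)
    exact h2.eval_natIndexed measurable_snd fun k => (hB (q n k)).measurable_mk
  have hae : ∀ᵐ ω ∂P, ∀ n k, B (q n k) ω = B' (q n k) ω :=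
    ae_all_iff.2 fun n => ae_all_iff.2 fun k => (hB _).ae_eq_mk
  have hq : ∀ t : ℝ≥0, Filter.Tendsto (fun n : ℕ => q n ⌊t * (n + 1)⌋₊) Filter.atTop (nhds t) := by
    intro t
    rw [← NNReal.tendsto_coe]
    have h := (tendsto_nat_floor_mul_div_atTop t.coe_nonneg).comp
      (tendsto_natCast_atTop_atTop.atTop_add (tendsto_const_nhds (x := (1 : ℝ))))
    refine h.congr fun n => ?_
    simp only [q, Function.comp_apply, NNReal.coe_div, NNReal.coe_natCast, NNReal.coe_add,
      NNReal.coe_one]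
    rw [show (t : ℝ) * (n + 1) = ((t * (n + 1) : ℝ≥0) : ℝ) by push_cast; rfl]
    rfl
  refine aestronglyMeasurable_of_tendsto_ae Filter.atTop
    (fun n => (hf n).aestronglyMeasurable) (f := f) ?_
  have hgood : ∀ᵐ ω ∂P, ∀ s : ℝ, Filter.Tendsto (fun n => f n (s, ω)) Filter.atTop
      (nhds (B s.toNNReal ω)) := by
    filter_upwards [hc, hae] with ω h1 h2 s
    refine ((h1.tendsto _).comp (hq s.toNNReal)).congr fun n => ?_
    exact h2 _ _
  filter_upwards [Measure.quasiMeasurePreserving_snd.ae hgood] with p hp using hp p.1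

end General

/-! ### Moment bounds for the local errors of the noise. -/

namespace IsFractionalBrownianMotion

variable {Ω : Type*} [MeasurableSpace Ω] {P : Measure Ω} {H σ : ℝ}
  {B : ℝ≥0 → Ω → ℝ}

lemma memLp_two (hB : IsFractionalBrownianMotion H σ B P) (t : ℝ≥0) : MemLp (B t) 2 P :=
  (hB.isGaussianProcess.hasGaussianLaw_eval t).memLp_two

variable [IsProbabilityMeasure P]

lemma integral_mul (hB : IsFractionalBrownianMotion H σ B P) (s t : ℝ≥0) :
    ∫ ω, B s ω * B t ω ∂P =
      σ ^ 2 / 2 * ((s : ℝ) ^ (2 * H) + (t : ℝ) ^ (2 * H) - |(t : ℝ) - (s : ℝ)| ^ (2 * H)) := by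
  have h := covariance_eq_sub (hB.memLp_two s) (hB.memLp_two t)
  rw [hB.mean_eq_zero, zero_mul, sub_zero, hB.covariance_eq] at h
  exact h.symm

lemma integral_sq (hB : IsFractionalBrownianMotion H σ B P) (hH : 0 < H) (t : ℝ≥0) :
    ∫ ω, B t ω ^ 2 ∂P = σ ^ 2 * (t : ℝ) ^ (2 * H) := by
  simp_rw [pow_two (B t _)]
  rw [hB.integral_mul, sub_self, abs_zero, Real.zero_rpow (by positivity)]
  ring

lemma integral_increment_mul (hB : IsFractionalBrownianMotion H σ B P) {a s b r : ℝ}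
    (ha : 0 ≤ a) (hs : 0 ≤ s) (hb : 0 ≤ b) (hr : 0 ≤ r) :
    ∫ ω, (B s.toNNReal ω - B a.toNNReal ω) * (B r.toNNReal ω - B b.toNNReal ω) ∂P =
      incrementCov H σ a s b r := by
  have hi : ∀ u v : ℝ≥0, Integrable (fun ω => B u ω * B v ω) P := fun u v =>
    (hB.memLp_two u).integrable_mul (hB.memLp_two v)
  have e : ∀ ω, (B s.toNNReal ω - B a.toNNReal ω) * (B r.toNNReal ω - B b.toNNReal ω) =
      (B s.toNNReal ω * B r.toNNReal ω - B s.toNNReal ω * B b.toNNReal ω) -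
        (B a.toNNReal ω * B r.toNNReal ω - B a.toNNReal ω * B b.toNNReal ω) := fun ω => by ring
  simp_rw [e]
  have hi' : ∀ u v w : ℝ≥0, Integrable (fun ω => B u ω * B v ω - B u ω * B w ω) P :=
    fun u v w => (hi u v).sub (hi u w)
  rw [integral_sub (hi' _ _ _) (hi' _ _ _), integral_sub (hi _ _) (hi _ _),
    integral_sub (hi _ _) (hi _ _)]
  simp only [hB.integral_mul, Real.coe_toNNReal _ ha, Real.coe_toNNReal _ hs,
    Real.coe_toNNReal _ hb, Real.coe_toNNReal _ hr, incrementCov]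
  rw [abs_sub_comm b s]
  ring

lemma memLp_two_prod (hB : IsFractionalBrownianMotion H σ B P) (hH : 0 < H) (u v : ℝ) :
    MemLp (fun p : ℝ × Ω => B p.1.toNNReal p.2) 2 ((volume.restrict (Set.Ioc u v)).prod P) := by
  have hm := aestronglyMeasurable_uncurry_of_ae_continuous hB.isGaussianProcess.aemeasurable
    hB.continuous_paths (volume.restrict (Set.Ioc u v))
  have hm2 : AEStronglyMeasurable (fun p : ℝ × Ω => B p.1.toNNReal p.2 ^ 2)
      ((volume.restrict (Set.Ioc u v)).prod P) := hm.pow 2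
  rw [memLp_two_iff_integrable_sq hm, integrable_prod_iff hm2]
  refine ⟨Filter.Eventually.of_forall fun s => (hB.memLp_two s.toNNReal).integrable_sq, ?_⟩
  have e : (fun s : ℝ => ∫ ω, ‖B s.toNNReal ω ^ 2‖ ∂P) =
      fun s : ℝ => σ ^ 2 * (s.toNNReal : ℝ) ^ (2 * H) := by
    funext s
    simp_rw [Real.norm_eq_abs, abs_of_nonneg (sq_nonneg (B _ _))]
    exact hB.integral_sq hH _
  dsimp only
  rw [e]
  have hc : Continuous fun s : ℝ => σ ^ 2 * (s.toNNReal : ℝ) ^ (2 * H) :=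
    continuous_const.mul ((NNReal.continuous_coe.comp continuous_real_toNNReal).rpow_const
      fun _ => Or.inr (by positivity))
  exact hc.integrableOn_Ioc

lemma memLp_two_increment_prod (hB : IsFractionalBrownianMotion H σ B P) (hH : 0 < H) (u v : ℝ)
    (a : ℝ≥0) :
    MemLp (Function.uncurry fun (s : ℝ) ω => B s.toNNReal ω - B a ω) 2
      ((volume.restrict (Set.Ioc u v)).prod P) :=
  (hB.memLp_two_prod hH u v).sub ((hB.memLp_two a).comp_snd _)

lemma memLp_two_integral_increment (hB : IsFractionalBrownianMotion H σ B P) (hH : 0 < H)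
    {u v : ℝ} (huv : u ≤ v) (a : ℝ≥0) :
    MemLp (fun ω => ∫ s in u..v, (B s.toNNReal ω - B a ω)) 2 P := by
  simp_rw [intervalIntegral.integral_of_le huv]
  exact (hB.memLp_two_increment_prod hH u v a).two_integral_prod

/-- Fubini twice: first in `s` against the whole second integral, then in `r` against a fixed
increment. -/
lemma integral_mul_integral_increment_le (hB : IsFractionalBrownianMotion H σ B P) (hH : 0 < H)
    {a a' b b' K : ℝ} (ha : 0 ≤ a) (haa : a ≤ a') (hb : 0 ≤ b) (hbb : b ≤ b')
    (hK : ∀ s ∈ Set.Icc a a', ∀ r ∈ Set.Icc b b', incrementCov H σ a s b r ≤ K) :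
    ∫ ω, (∫ s in a..a', (B s.toNNReal ω - B a.toNNReal ω)) *
      (∫ r in b..b', (B r.toNNReal ω - B b.toNNReal ω)) ∂P ≤ (a' - a) * ((b' - b) * K) := by
  have hvol : ∀ {u v : ℝ}, u ≤ v → (volume.restrict (Set.Ioc u v)).real Set.univ = v - u :=
    fun {u v} h => by
      rw [measureReal_restrict_apply_univ, Real.volume_real_Ioc_of_le h]
  simp_rw [mul_comm (∫ s in a..a', _)]
  have hD := hB.memLp_two_integral_increment hH hbb b.toNNReal
  simp only [intervalIntegral.integral_of_le haa]
  rw [← hvol haa]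
  refine integral_mul_integral_le_of_memLp hD (hB.memLp_two_increment_prod hH a a' _) ?_
  filter_upwards [ae_restrict_mem measurableSet_Ioc] with s hs
  simp_rw [mul_comm _ (B s.toNNReal _ - _), intervalIntegral.integral_of_le hbb]
  rw [← hvol hbb]
  refine integral_mul_integral_le_of_memLp ((hB.memLp_two _).sub (hB.memLp_two _))
    (hB.memLp_two_increment_prod hH b b' _) ?_
  filter_upwards [ae_restrict_mem measurableSet_Ioc] with r hr
  simp only [Pi.sub_apply]
  rw [hB.integral_increment_mul ha (ha.trans hs.1.le) hb (hb.trans hr.1.le)]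
  exact hK s (Set.Ioc_subset_Icc_self hs) r (Set.Ioc_subset_Icc_self hr)

/-- First moment bound for weighted sums of the local errors
`∫ s in t_j..t_{j+1}, (B s - B t_j)`, with weights in `[0, 1]`. -/
lemma integral_abs_sum_le (hB : IsFractionalBrownianMotion H σ B P) (hH : 0 < H) (hσ : 0 < σ)
    {T : ℝ} (hT : 0 < T) {N : ℕ} (hN : 1 ≤ N) {n : ℕ} (hn : n ≤ N) {w : ℕ → ℝ}
    (hw0 : ∀ j, 0 ≤ w j) (hw1 : ∀ j, w j ≤ 1) :
    ∫ ω, |∑ j ∈ Finset.range n, w j * ∫ s in (meshPoint T N j)..(meshPoint T N (j + 1)),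
        (B s.toNNReal ω - B (meshPoint T N j).toNNReal ω)| ∂P ≤
      (σ * T ^ (1 / 2 : ℝ) + σ * T ^ H) *
        timeStep T N ^ (if H < 1 / 2 then H + 1 / 2 else 1) := by
  obtain ⟨K, hK0, hK, hKsum⟩ := exists_incrementCov_bound (σ := σ) hH hT.le N hN
  have hΔ := timeStep_pos hT hN
  set Δ := timeStep T N
  set t := meshPoint T N
  have hle : ∀ j, t j ≤ t (j + 1) := fun j => monotone_meshPoint hT.le N j.le_succ
  have ht0 : ∀ j, 0 ≤ t j := meshPoint_nonneg hT.le N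
  have hstep : ∀ i, t (i + 1) - t i = Δ := meshPoint_succ_sub T N
  set D : ℕ → Ω → ℝ := fun j ω => ∫ s in (t j)..(t (j + 1)), (B s.toNNReal ω - B (t j).toNNReal ω)
    with hD
  have hDL : ∀ j, MemLp (D j) 2 P := fun j =>
    hB.memLp_two_integral_increment hH (hle j) (t j).toNNReal
  have hDD : ∀ i j, ∫ ω, D i ω * D j ω ∂P ≤ Δ * (Δ * K i j) := fun i j => by
    have := hB.integral_mul_integral_increment_le hH (ht0 i) (hle i) (ht0 j) (hle j) (hK i j)
    rwa [hstep, hstep] at this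
  have hJ : MemLp (fun ω => |∑ j ∈ Finset.range n, w j * D j ω|) 2 P :=
    (memLp_finsetSum _ fun j _ => (hDL j).const_mul (w j)).abs
  have h1 := sq_integral_le_measureReal_mul_integral_sq hJ
  rw [probReal_univ, one_mul] at h1
  -- After expanding the square, `K i j ≥ 0` allows each product of weights to be replaced by `1`.
  have h2 : ∫ ω, |∑ j ∈ Finset.range n, w j * D j ω| ^ 2 ∂P ≤
      Δ ^ 2 * ∑ i ∈ Finset.range n, ∑ j ∈ Finset.range n, K i j := by
    have e : ∀ ω, |∑ j ∈ Finset.range n, w j * D j ω| ^ 2 =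
        ∑ i ∈ Finset.range n, ∑ j ∈ Finset.range n, (w i * w j) * (D i ω * D j ω) := fun ω => by
      rw [sq_abs, pow_two, Finset.sum_mul_sum]
      exact Finset.sum_congr rfl fun i _ => Finset.sum_congr rfl fun j _ => by ring
    have hint : ∀ i j, Integrable (fun ω => (w i * w j) * (D i ω * D j ω)) P := fun i j =>
      ((hDL i).integrable_mul (hDL j)).const_mul _
    simp_rw [e]
    rw [integral_finsetSum _ fun i _ => integrable_finsetSum _ fun j _ => hint i j, Finset.mul_sum]
    refine Finset.sum_le_sum fun i _ => ?_
    rw [integral_finsetSum _ fun j _ => hint i j, Finset.mul_sum]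
    refine Finset.sum_le_sum fun j _ => ?_
    rw [integral_const_mul]
    calc w i * w j * ∫ ω, D i ω * D j ω ∂P ≤ w i * w j * (Δ * (Δ * K i j)) :=
          mul_le_mul_of_nonneg_left (hDD i j) (mul_nonneg (hw0 i) (hw0 j))
      _ ≤ 1 * (Δ * (Δ * K i j)) := by
          refine mul_le_mul_of_nonneg_right (mul_le_one₀ (hw1 i) (hw0 j) (hw1 j)) ?_
          have := hK0 i j
          positivity
      _ = _ := by ring
  -- In each regime the bound is the exact square of one summand of the constant times the power of
  -- `Δ`.
  have h3 : Δ ^ 2 * ∑ i ∈ Finset.range n, ∑ j ∈ Finset.range n, K i j ≤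
      ((σ * T ^ (1 / 2 : ℝ) + σ * T ^ H) * Δ ^ (if H < 1 / 2 then H + 1 / 2 else 1)) ^ 2 := by
    have hc1 : 0 < σ * T ^ (1 / 2 : ℝ) := by positivity
    have hc2 : 0 < σ * T ^ H := by positivity
    have hsq : ∀ {x : ℝ} (y : ℝ), 0 < x → (x ^ y) ^ 2 = x ^ (2 * y) := fun {x} y hx => by
      rw [← Real.rpow_natCast, ← Real.rpow_mul hx.le, mul_comm]; norm_num
    refine (mul_le_mul_of_nonneg_left (hKsum n hn) (sq_nonneg Δ)).trans ?_
    split_ifs with h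
    · calc Δ ^ 2 * (σ ^ 2 * T * Δ ^ (2 * H - 1))
          = ((σ * T ^ (1 / 2 : ℝ)) * Δ ^ (H + 1 / 2)) ^ 2 := by
            rw [mul_pow, mul_pow, hsq _ hT, hsq _ hΔ,
              show 2 * (H + 1 / 2) = 2 + (2 * H - 1) by ring, Real.rpow_add hΔ]
            norm_num
            ring
        _ ≤ _ := by gcongr; linarith
    · calc Δ ^ 2 * (σ ^ 2 * T ^ (2 * H)) = ((σ * T ^ H) * Δ ^ (1 : ℝ)) ^ 2 := by
            rw [mul_pow, mul_pow, hsq _ hT, Real.rpow_one]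
            ring
        _ ≤ _ := by gcongr; linarith
  exact le_of_sq_le_sq (h1.trans (h2.trans h3)) (by positivity)

end IsFractionalBrownianMotion

/-! ### Integrability and strong order of the Euler scheme. -/

section Error

variable {Ω : Type*} [MeasurableSpace Ω] {P : Measure Ω} [IsProbabilityMeasure P] {H σ T : ℝ}
  {B : ℝ≥0 → Ω → ℝ} {X₀ : Ω → ℝ} {X : ℝ → Ω → ℝ}

lemma IsFractionalBrownianMotion.integrable_bound (hB : IsFractionalBrownianMotion H σ B P)
    (hH : 0 < H) (hT : 0 ≤ T) (hX₀ : MemLp X₀ 2 P) :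
    Integrable (fun ω => |X₀ ω| + ∫ s in (0 : ℝ)..T, |B s.toNNReal ω|) P := by
  simp_rw [intervalIntegral.integral_of_le hT]
  have h : MemLp (Function.uncurry fun (s : ℝ) ω => |B s.toNNReal ω|) 2
      ((volume.restrict (Set.Ioc 0 T)).prod P) := (hB.memLp_two_prod hH 0 T).abs
  exact (hX₀.integrable one_le_two).abs.add (h.two_integral_prod.integrable one_le_two)

/-- Being a solution does not include measurability in `ω`; it comes from the explicit formula. -/
lemma IsRODESolution.integrable (hH0 : 0 < H) (hT : 0 < T)
    (hB : IsFractionalBrownianMotion H σ B P) (hX₀ : MemLp X₀ 2 P)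
    (hX : IsRODESolution (fun (_ : ℝ) (x y : ℝ) => -x + y) T B X₀ X P) {t : ℝ}
    (ht : t ∈ Set.Icc 0 T) : Integrable (X t) P := by
  have hm : AEStronglyMeasurable
      (fun ω => Real.exp (-t) * (X₀ ω + ∫ s in (0 : ℝ)..t, Real.exp s * B s.toNNReal ω)) P := by
    simp_rw [intervalIntegral.integral_of_le ht.1]
    have h : AEStronglyMeasurable (fun p : ℝ × Ω => Real.exp p.1 * B p.1.toNNReal p.2)
        ((volume.restrict (Set.Ioc 0 t)).prod P) :=
      (Real.continuous_exp.comp_aestronglyMeasurable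
        measurable_fst.aestronglyMeasurable).mul (hB.memLp_two_prod hH0 0 t).1
    exact (hX₀.1.add h.prod_swap.integral_prod_right').const_mul _
  have hboth : ∀ᵐ ω ∂P,
      Real.exp (-t) * (X₀ ω + ∫ s in (0 : ℝ)..t, Real.exp s * B s.toNNReal ω) = X t ω ∧
      ‖X t ω‖ ≤ |X₀ ω| + ∫ s in (0 : ℝ)..T, |B s.toNNReal ω| := by
    filter_upwards [hX, hB.continuous_paths] with ω h1 h2
    have hb : Continuous fun s : ℝ => B s.toNNReal ω := h2.comp continuous_real_toNNReal
    exact ⟨(linearODE_eq hb hT.le h1.1 h1.2 ht).symm, linearODE_abs_le hb hT.le h1.1 h1.2 ht⟩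
  exact (hB.integrable_bound hH0 hT.le hX₀).mono' (hm.congr (hboth.mono fun _ h => h.1))
    (hboth.mono fun _ h => h.2)

lemma integrable_eulerScheme (hB : IsFractionalBrownianMotion H σ B P) (hX₀ : MemLp X₀ 2 P)
    (N j : ℕ) :
    Integrable (eulerScheme (fun (_ : ℝ) (x y : ℝ) => -x + y) T B X₀ N j) P := by
  induction j with
  | zero => exact hX₀.integrable one_le_two
  | succ j ih =>
    exact ih.add ((ih.neg.add ((hB.memLp_two _).integrable one_le_two)).smul (timeStep T N))

lemma integrableErrors_eulerScheme (hH0 : 0 < H) (hT : 0 < T)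
    (hB : IsFractionalBrownianMotion H σ B P) (hX₀ : MemLp X₀ 2 P)
    (hX : IsRODESolution (fun (_ : ℝ) (x y : ℝ) => -x + y) T B X₀ X P) :
    IntegrableErrors T X (eulerScheme (fun (_ : ℝ) (x y : ℝ) => -x + y) T B X₀) P :=
  fun N hN j hj => (hX.integrable hH0 hT hB hX₀
    ⟨meshPoint_nonneg hT.le N j, meshPoint_le hT.le hN hj⟩).sub (integrable_eulerScheme hB hX₀ N j)

lemma integral_error_le (hH0 : 0 < H) (hσ : 0 < σ) (hT : 0 < T)
    (hB : IsFractionalBrownianMotion H σ B P) (hX₀ : MemLp X₀ 2 P)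
    (hX : IsRODESolution (fun (_ : ℝ) (x y : ℝ) => -x + y) T B X₀ X P) {N n : ℕ} (hN : 1 ≤ N)
    (hΔ : timeStep T N ≤ 1) (hn : n ≤ N) :
    ∫ ω, ‖X (meshPoint T N n) ω -
        eulerScheme (fun (_ : ℝ) (x y : ℝ) => -x + y) T B X₀ N n ω‖ ∂P ≤
      timeStep T N * ((T + 1) * ∫ ω, (|X₀ ω| + ∫ s in (0 : ℝ)..T, |B s.toNNReal ω|) ∂P) +
        (σ * T ^ (1 / 2 : ℝ) + σ * T ^ H) *
          timeStep T N ^ (if H < 1 / 2 then H + 1 / 2 else 1) := by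
  have hΔ0 : 0 ≤ timeStep T N := timeStep_nonneg hT.le N
  have hM := ((hB.integrable_bound hH0 hT.le hX₀).const_mul (T + 1)).const_mul (timeStep T N)
  have hJ : Integrable (fun ω => |∑ j ∈ Finset.range n, (1 - timeStep T N) ^ (n - 1 - j) *
      ∫ s in (meshPoint T N j)..(meshPoint T N (j + 1)),
        (B s.toNNReal ω - B (meshPoint T N j).toNNReal ω)|) P :=
    (integrable_finsetSum _ fun j _ => ((hB.memLp_two_integral_increment hH0
      (monotone_meshPoint hT.le N j.le_succ) _).integrable one_le_two).const_mul _).abs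
  calc _ ≤ ∫ ω, (timeStep T N * ((T + 1) *
        (|X₀ ω| + ∫ s in (0 : ℝ)..T, |B s.toNNReal ω|)) +
        |∑ j ∈ Finset.range n, (1 - timeStep T N) ^ (n - 1 - j) *
          ∫ s in (meshPoint T N j)..(meshPoint T N (j + 1)),
            (B s.toNNReal ω - B (meshPoint T N j).toNNReal ω)|) ∂P := by
        refine integral_mono_ae (integrableErrors_eulerScheme hH0 hT hB hX₀ hX N hN n hn).norm
          (hM.add hJ) ?_
        filter_upwards [hX, hB.continuous_paths] with ω h1 h2
        have hb : Continuous fun s : ℝ => B s.toNNReal ω := h2.comp continuous_real_toNNReal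
        exact linearODE_euler_error_le hb hT.le h1.1 h1.2 hN hΔ
          (y := fun j => eulerScheme (fun (_ : ℝ) (x y : ℝ) => -x + y) T B X₀ N j ω) rfl
          (fun j => rfl) hn
    _ ≤ _ := by
        rw [integral_add hM hJ, integral_const_mul, integral_const_mul]
        gcongr
        exact hB.integral_abs_sum_le hH0 hσ hT hN hn
          (fun j => pow_nonneg (by linarith) _) (fun j => pow_le_one₀ (by linarith) (by linarith))

lemma hasStrongOrder_eulerScheme (hH0 : 0 < H) (hσ : 0 < σ) (hT : 0 < T)
    (hB : IsFractionalBrownianMotion H σ B P) (hX₀ : MemLp X₀ 2 P)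
    (hX : IsRODESolution (fun (_ : ℝ) (x y : ℝ) => -x + y) T B X₀ X P) :
    HasStrongOrder (if H < 1 / 2 then H + 1 / 2 else 1) T X
      (eulerScheme (fun (_ : ℝ) (x y : ℝ) => -x + y) T B X₀) P := by
  refine ⟨integrableErrors_eulerScheme hH0 hT hB hX₀ hX, ?_⟩
  set XN := eulerScheme (fun (_ : ℝ) (x y : ℝ) => -x + y) T B X₀ with hXN
  set θ : ℝ := if H < 1 / 2 then H + 1 / 2 else 1 with hθ
  have hθ0 : 0 ≤ θ := by rw [hθ]; split_ifs <;> linarith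
  have hθ1 : θ ≤ 1 := by rw [hθ]; split_ifs <;> linarith
  set C₁ := (T + 1) * ∫ ω, (|X₀ ω| + ∫ s in (0 : ℝ)..T, |B s.toNNReal ω|) ∂P with hC₁
  set C₂ := σ * T ^ (1 / 2 : ℝ) + σ * T ^ H with hC₂
  have hC₁0 : 0 ≤ C₁ := mul_nonneg (by linarith) (integral_nonneg fun ω =>
    add_nonneg (abs_nonneg _) (intervalIntegral.integral_nonneg hT.le fun _ _ => abs_nonneg _))
  have hC₂0 : 0 ≤ C₂ := by positivity
  have hs0 : ∀ N, 0 ≤ strongError T X XN P N := fun N =>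
    (integral_nonneg fun _ => norm_nonneg _).trans
      (Finset.le_sup' (fun j => ∫ ω, ‖X (meshPoint T N j) ω - XN N j ω‖ ∂P)
        (Finset.mem_range.2 N.succ_pos))
  -- A step larger than `1` means `N < T`; the sum of these finitely many errors bounds each of
  -- them, and then `1 ≤ Δ ^ θ`.
  set C₃ := ∑ N ∈ Finset.range ⌈T⌉₊, strongError T X XN P N with hC₃
  have hC₃0 : 0 ≤ C₃ := Finset.sum_nonneg fun N _ => hs0 N
  refine ⟨C₁ + C₂ + C₃, by positivity, fun N hN => ?_⟩
  have hΔ0 := timeStep_pos hT hN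
  rcases le_or_gt (timeStep T N) 1 with hΔ | hΔ
  · refine Finset.sup'_le _ _ fun n hn => ?_
    have h := integral_error_le hH0 hσ hT hB hX₀ hX hN hΔ (Nat.lt_succ_iff.1 (Finset.mem_range.1 hn))
    -- Since `Δ ≤ 1` and `θ ≤ 1`, the first-order term is absorbed.
    have hpow : timeStep T N ≤ timeStep T N ^ θ := by
      simpa using Real.rpow_le_rpow_of_exponent_ge hΔ0 hΔ hθ1
    calc _ ≤ timeStep T N * C₁ + C₂ * timeStep T N ^ θ := h
      _ ≤ timeStep T N ^ θ * C₁ + C₂ * timeStep T N ^ θ + C₃ * timeStep T N ^ θ := by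
          have := mul_le_mul_of_nonneg_right hpow hC₁0
          have : 0 ≤ C₃ * timeStep T N ^ θ := by positivity
          linarith
      _ = _ := by ring
  · have hNT : (N : ℝ) < T := by
      rw [timeStep, lt_div_iff₀ (by positivity)] at hΔ
      linarith
    have h1 : strongError T X XN P N ≤ C₃ :=
      Finset.single_le_sum (fun N _ => hs0 N) (Finset.mem_range.2 (Nat.lt_ceil.2 hNT))
    have h2 : 1 ≤ timeStep T N ^ θ := Real.one_le_rpow hΔ.le hθ0
    calc strongError T X XN P N ≤ (C₁ + C₂ + C₃) * 1 := by linarith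
      _ ≤ _ := by gcongr

end Error

theorem mainTheorem3 {Ω : Type*} [MeasurableSpace Ω] (P : Measure Ω) [IsProbabilityMeasure P]
    (H σ T : ℝ) (hH0 : 0 < H) (hH1 : H < 1) (hσ : 0 < σ) (hT : 0 < T)
    (B : ℝ≥0 → Ω → ℝ) (hB : IsFractionalBrownianMotion H σ B P)
    (X₀ : Ω → ℝ) (hX₀ : MemLp X₀ 2 P)
    (X : ℝ → Ω → ℝ)
    (hX : IsRODESolution (fun (_ : ℝ) (x y : ℝ) => -x + y) T B X₀ X P) :
    let XN : ℕ → ℕ → Ω → ℝ := eulerScheme (fun (_ : ℝ) (x y : ℝ) => -x + y) T B X₀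
    IntegrableErrors T X XN P ∧
    (∃ c₁ c₂ : ℝ, 0 ≤ c₁ ∧ 0 ≤ c₂ ∧ ∀ N : ℕ, 1 ≤ N →
      strongError T X XN P N ≤ c₁ * timeStep T N + c₂ * timeStep T N ^ (H + 1 / 2)) ∧
    (H < 1 / 2 → HasStrongOrder (H + 1 / 2) T X XN P) ∧
    (1 / 2 ≤ H → HasStrongOrder 1 T X XN P) := by
  have hS := hasStrongOrder_eulerScheme hH0 hσ hT hB hX₀ hX
  refine ⟨hS.1, ?_, fun h => ?_, fun h => ?_⟩
  -- The strong order already gives the dominant term, so the other constant can be `0`.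
  · obtain ⟨-, C, hC0, hC⟩ := hS
    rcases lt_or_ge H (1 / 2) with h | h
    · rw [if_pos h] at hC
      exact ⟨0, C, le_rfl, hC0, fun N hN => by simpa only [zero_mul, zero_add] using hC N hN⟩
    · rw [if_neg h.not_gt] at hC
      exact ⟨C, 0, hC0, le_rfl, fun N hN => by
        simpa only [zero_mul, add_zero, Real.rpow_one] using hC N hN⟩
  · rwa [if_pos h] at hS
  · rwa [if_neg h.not_gt] at hS
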